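/- We work over $\mathbb C$. Let $n\ge 0$, let $[d_1,\dots,d_k]$ (with $d_1\ge\dots\ge d_k\ge 1$) be a partition of $n$, and let $\mathcal O\subset\mathfrak{sl}(n)$ be the nilpotent orbit of Jordan type $[d_1,\dots,d_k]$, with closure $\overline{\mathcal O}$ (an affine variety, with its reduced structure). Let $[s_1,\dots,s_m]$ be the dual partition, $m=d_1$ (and $m=0$ if $n=0$), $s_j=\#\{i : d_i\ge j\}$. For a sequence $(i_1,\dots,i_m)$ of positive integers with sum $n$, let $P_{i_1,\dots,i_m}\subset SL(n)$ denote a parabolic subgroup of flag type $(i_1,\dots,i_m)$, i.e. the stabilizer of a flag $0=V_0\subset V_1\subset\dots\subset V_m=\mathbb C^n$ with $\dim V_j/V_{j-1}=i_j$ for $1\le j\le m$. The cotangent bundle of $SL(n)/P$, $P=P_{i_1,\dots,i_m}$, is the homogeneous bundle $$T^*(SL(n)/P)=SL(n)\times^{P}\mathfrak n_P,\qquad \mathfrak n_P=\{x\in\mathfrak{sl}(n): x(V_j)\subset V_{j-1}\text{ for }1\le j\le m\},$$ the quotient variety of $SL(n)\times\mathfrak n_P$ by the action of $P$ given by $p\cdot(g,x)=(gp^{-1},pxp^{-1})$;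 the Springer map $T^*(SL(n)/P)\to\mathfrak{sl}(n)$ is $[g,x]\mapsto gxg^{-1}$. Let $\sigma$ be any permutation of $\{1,\dots,m\}$. Then, for any choice of parabolic subgroups of flag types $(s_{\sigma(1)},\dots,s_{\sigma(m)})$ and $(s_{\sigma(m)},\dots,s_{\sigma(1)})$, the two Springer maps take values in $\overline{\mathcal O}$, and the resulting morphisms (the Springer resolutions) $$\pi: X=T^*(SL(n)/P_{s_{\sigma(1)},\dots,s_{\sigma(m)}})\to\overline{\mathcal O},\qquad \pi^+: X^+=T^*(SL(n)/P_{s_{\sigma(m)},\dots,s_{\sigma(1)}})\to\overline{\mathcal O}$$ are equivalent: there are an automorphism $\psi$ of the variety $\overline{\mathcal O}$ and an isomorphism of varieties $\Phi: X^+\to X$ such that $\psi\circ\pi\circ\Phi=\pi^+$. -/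

import Mathlib

open TopologicalSpace

/-! ### Algebraic varieties over `ℂ` as spaces with functions

A (classical) algebraic variety is a topological space (its closed points with the Zariski
topology) with a sheaf of `ℂ`-algebras of `ℂ`-valued functions. -/

/-- A topological space together with a sheaf of `ℂ`-algebras of `ℂ`-valued functions. -/
structure FunctionedSpace where
  carrier : Type
  top : TopologicalSpace carrier
  /-- the algebra of regular functions on an open set -/
  regular : (U : Opens carrier) → Subalgebra ℂ (U → ℂ)
  regular_res : ∀ {U V : Opens carrier} (h : V ≤ U) (f : U → ℂ), f ∈ regular U →
    (fun y : V => f ⟨y.1, h y.2⟩) ∈ regular V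
  regular_glue : ∀ (U : Opens carrier) (f : U → ℂ),
    (∀ x : U, ∃ (V : Opens carrier) (h : V ≤ U), x.1 ∈ V ∧
      (fun y : V => f ⟨y.1, h y.2⟩) ∈ regular V) → f ∈ regular U

namespace FunctionedSpace

instance : CoeSort FunctionedSpace Type := ⟨FunctionedSpace.carrier⟩

instance (X : FunctionedSpace) : TopologicalSpace X := X.top

/-- A map is a morphism if it is continuous and pulls regular functions back to regular
functions. -/
def IsMorphism (X Y : FunctionedSpace) (f : X → Y) : Prop :=
  ∃ hf : Continuous f, ∀ (U : Opens Y) (u : U → ℂ), u ∈ Y.regular U →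
    (fun x : Opens.comap ⟨f, hf⟩ U => u ⟨f x.1, x.2⟩) ∈ X.regular (Opens.comap ⟨f, hf⟩ U)

/-- Morphisms of varieties. -/
structure Hom (X Y : FunctionedSpace) where
  toFun : X → Y
  isMorphism : IsMorphism X Y toFun

/-- Isomorphisms of varieties. -/
structure Iso (X Y : FunctionedSpace) where
  toEquiv : X.carrier ≃ Y.carrier
  isMorphism : IsMorphism X Y toEquiv
  isMorphism_symm : IsMorphism Y X toEquiv.symm

/-- Two varieties `π₁ : X₁ → W`, `π₂ : X₂ → W` over `W` are isomorphic: there is an isomorphism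
`X₂ → X₁` over `W`.  For birational `π₁`, `π₂` (e.g. resolutions) this says that the birational
map `π₁⁻¹ ∘ π₂` is an isomorphism. -/
def Hom.Isomorphic {X₁ X₂ W : FunctionedSpace} (π₁ : Hom X₁ W) (π₂ : Hom X₂ W) : Prop :=
  ∃ Φ : Iso X₂ X₁, ∀ x, π₁.toFun (Φ.toEquiv x) = π₂.toFun x

theorem IsMorphism.comp {X Y Z : FunctionedSpace} {g : Y → Z} {f : X → Y}
    (hg : IsMorphism Y Z g) (hf : IsMorphism X Y f) : IsMorphism X Z (g ∘ f) := by
  obtain ⟨cg, hg⟩ := hg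
  obtain ⟨cf, hf⟩ := hf
  exact ⟨cg.comp cf, fun U u hu => hf _ _ (hg U u hu)⟩

/-- Composition of morphisms. -/
def Hom.comp {X Y Z : FunctionedSpace} (g : Hom Y Z) (f : Hom X Y) : Hom X Z :=
  ⟨g.toFun ∘ f.toFun, g.isMorphism.comp f.isMorphism⟩

/-- The morphism underlying an isomorphism. -/
def Iso.hom {X Y : FunctionedSpace} (e : Iso X Y) : Hom X Y := ⟨e.toEquiv, e.isMorphism⟩

/-- `π₁` and `π₂` are equivalent: `ψ ∘ π₁` and `π₂` are isomorphic for some automorphism `ψ`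
of `W`. -/
def Hom.Equivalent {X₁ X₂ W : FunctionedSpace} (π₁ : Hom X₁ W) (π₂ : Hom X₂ W) : Prop :=
  ∃ ψ : Iso W W, (ψ.hom.comp π₁).Isomorphic π₂

/-- The Zariski topology on a set `Y` with coordinate functions `c`: a basis of open sets is given
by the non-vanishing loci of polynomials in the coordinates. -/
@[reducible] def zariski {Y ι : Type} (c : Y → ι → ℂ) : TopologicalSpace Y :=
  generateFrom {D | ∃ p : MvPolynomial ι ℂ, D = {y | MvPolynomial.eval (c y) p ≠ 0}}

/-- A set `Y` with coordinate functions `c : Y → ℂ^ι` as a space with functions: the Zariski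
topology, and as regular functions those which are locally quotients of polynomials in the
coordinates.  If `c` is injective with Zariski closed image, this is the affine variety
`c(Y) ⊆ ℂ^ι`. -/
def affine {Y ι : Type} (c : Y → ι → ℂ) : FunctionedSpace :=
  letI := zariski c
  { carrier := Y
    top := zariski c
    regular := fun U =>
      { carrier := {f | ∀ x : U, ∃ p q : MvPolynomial ι ℂ, ∃ V : Opens Y, x.1 ∈ V ∧
          ∀ y : U, y.1 ∈ V → MvPolynomial.eval (c y.1) q ≠ 0 ∧
            f y = MvPolynomial.eval (c y.1) p / MvPolynomial.eval (c y.1) q}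
        mul_mem' := by
          intro f g hf hg x
          obtain ⟨p, q, V, hV, h⟩ := hf x
          obtain ⟨p', q', V', hV', h'⟩ := hg x
          refine ⟨p * p', q * q', V ⊓ V', ⟨hV, hV'⟩, fun y hy => ?_⟩
          obtain ⟨h1, h2⟩ := h y hy.1
          obtain ⟨h1', h2'⟩ := h' y hy.2
          refine ⟨by simp [h1, h1'], ?_⟩
          simp only [Pi.mul_apply, h2, h2', map_mul]
          field_simp
        add_mem' := by
          intro f g hf hg x
          obtain ⟨p, q, V, hV, h⟩ := hf x
          obtain ⟨p', q', V', hV', h'⟩ := hg x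
          refine ⟨p * q' + p' * q, q * q', V ⊓ V', ⟨hV, hV'⟩, fun y hy => ?_⟩
          obtain ⟨h1, h2⟩ := h y hy.1
          obtain ⟨h1', h2'⟩ := h' y hy.2
          refine ⟨by simp [h1, h1'], ?_⟩
          simp only [Pi.add_apply, h2, h2', map_mul, map_add]
          field_simp
        algebraMap_mem' := by
          intro r x
          exact ⟨MvPolynomial.C r, 1, ⊤, trivial, fun y _ => by simp⟩ }
    regular_res := by
      intro U V h f hf x
      obtain ⟨p, q, O, hO, hpq⟩ := hf ⟨x.1, h x.2⟩
      exact ⟨p, q, O, hO, fun y hy => hpq ⟨y.1, h y.2⟩ hy⟩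
    regular_glue := by
      intro U f hf x
      obtain ⟨V, h, hxV, hreg⟩ := hf x
      obtain ⟨p, q, O, hO, hpq⟩ := hreg ⟨x.1, hxV⟩
      exact ⟨p, q, O ⊓ V, ⟨hO, hxV⟩, fun y hy => hpq ⟨y.1, hy.2⟩ hy.1⟩ }

/-- The quotient of a space with functions by an equivalence relation: it has the quotient
topology, and a function on an open set is regular iff its pullback is regular. -/
def quotient (X : FunctionedSpace) (r : Setoid X) : FunctionedSpace :=
  { carrier := Quotient r
    top := inferInstance
    regular := fun U =>
      { carrier := {f |
          (fun x : Opens.comap ⟨Quotient.mk r, continuous_quotient_mk'⟩ U =>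
            f ⟨Quotient.mk r x.1, x.2⟩) ∈ X.regular _}
        mul_mem' := fun hf hg => Subalgebra.mul_mem _ hf hg
        add_mem' := fun hf hg => Subalgebra.add_mem _ hf hg
        algebraMap_mem' := fun a => Subalgebra.algebraMap_mem _ a }
    regular_res := by
      intro U V h f hf
      exact X.regular_res
        (U := Opens.comap ⟨Quotient.mk r, continuous_quotient_mk'⟩ U)
        (V := Opens.comap ⟨Quotient.mk r, continuous_quotient_mk'⟩ V) (fun _ hx => h hx) _ hf
    regular_glue := by
      intro U f hf
      refine X.regular_glue _ _ fun x => ?_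
      obtain ⟨V, h, hxV, hreg⟩ := hf ⟨Quotient.mk r x.1, x.2⟩
      exact ⟨Opens.comap ⟨Quotient.mk r, continuous_quotient_mk'⟩ V, fun _ hx => h hx, hxV, hreg⟩ }

end FunctionedSpace

/-! ### Nilpotent orbits in `𝔰𝔩(n)` -/

/-- The underlying matrix of an element of `SL(n)`. -/
def mat {n : ℕ} : Matrix.SpecialLinearGroup (Fin n) ℂ →* Matrix (Fin n) (Fin n) ℂ where
  toFun g := g.1
  map_one' := rfl
  map_mul' _ _ := rfl

theorem mat_mul_mat_inv {n : ℕ} (g : Matrix.SpecialLinearGroup (Fin n) ℂ) :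
    mat g * mat g⁻¹ = 1 := by
  rw [← map_mul, mul_inv_cancel, map_one]

/-- The nilpotent Jordan block of size `r`. -/
def jordanBlock (r : ℕ) : Matrix (Fin r) (Fin r) ℂ :=
  Matrix.of fun a b => if (a : ℕ) + 1 = b then 1 else 0

/-- The nilpotent orbit of Jordan type `[d 0, …, d (k-1)]`: all `SL(n)`-conjugates of the
block diagonal matrix (with respect to some numbering of its rows and columns) with nilpotent
Jordan blocks of sizes `d 0, …, d (k-1)`.  It is empty unless `∑ i, d i = n`. -/
def nilpotentOrbit (n : ℕ) {k : ℕ} (d : Fin k → ℕ) : Set (Matrix (Fin n) (Fin n) ℂ) :=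
  {x | ∃ (e : (Σ i : Fin k, Fin (d i)) ≃ Fin n) (g : Matrix.SpecialLinearGroup (Fin n) ℂ),
    x = mat g * Matrix.reindex e e (Matrix.blockDiagonal' fun i => jordanBlock (d i)) * mat g⁻¹}

/-- The matrix entries as coordinates. -/
def matrixCoord {n : ℕ} (x : Matrix (Fin n) (Fin n) ℂ) : Fin n × Fin n → ℂ :=
  fun a => x a.1 a.2

/-- The Zariski closure of a set of matrices. -/
def zariskiClosure {n : ℕ} (S : Set (Matrix (Fin n) (Fin n) ℂ)) :
    Set (Matrix (Fin n) (Fin n) ℂ) :=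
  {x | ∀ p : MvPolynomial (Fin n × Fin n) ℂ,
    (∀ y ∈ S, MvPolynomial.eval (matrixCoord y) p = 0) →
      MvPolynomial.eval (matrixCoord x) p = 0}

/-- The affine variety `closure of 𝒪`, for the nilpotent orbit `𝒪` of Jordan type `d`. -/
def orbitClosure (n : ℕ) {k : ℕ} (d : Fin k → ℕ) : FunctionedSpace :=
  FunctionedSpace.affine
    (fun x : zariskiClosure (nilpotentOrbit n d) => matrixCoord x.1)

/-- The underlying matrix of a point of the orbit closure. -/
def orbitClosure.val {n k : ℕ} {d : Fin k → ℕ} (x : orbitClosure n d) :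
    Matrix (Fin n) (Fin n) ℂ :=
  Subtype.val (p := fun y => y ∈ zariskiClosure (nilpotentOrbit n d)) x

/-- The number of parts of the dual partition of `d`, that is, the largest part of `d`. -/
def dualLength {k : ℕ} (d : Fin k → ℕ) : ℕ := Finset.univ.sup d

/-- The dual partition of `d`; its `j`-th part (counting from `0`) is `#{i | j < d i}`. -/
def dualPart {k : ℕ} (d : Fin k → ℕ) (j : Fin (dualLength d)) : ℕ :=
  (Finset.univ.filter fun i => (j : ℕ) < d i).card

/-! ### Parabolic subgroups and cotangent bundles of flag varieties -/

/-- A flag `0 = V 0 ⊆ V 1 ⊆ ⋯ ⊆ V m = ℂⁿ` of type `i`: `dim V (j+1) / V j = i j`. -/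
structure PartialFlag (n : ℕ) {m : ℕ} (i : Fin m → ℕ) where
  V : Fin (m + 1) → Submodule ℂ (Fin n → ℂ)
  mono : Monotone V
  bot : V 0 = ⊥
  top : V (Fin.last m) = ⊤
  dim : ∀ j : Fin m, Module.finrank ℂ (V j.succ) = Module.finrank ℂ (V j.castSucc) + i j

namespace PartialFlag

open Matrix

variable {n m : ℕ} {i : Fin m → ℕ}

/-- The parabolic subgroup of `SL(n)` of flag type `i`: the stabilizer of the flag. -/
def parabolic (F : PartialFlag n i) : Subgroup (SpecialLinearGroup (Fin n) ℂ) where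
  carrier := {g | ∀ j v, mat g *ᵥ v ∈ F.V j ↔ v ∈ F.V j}
  one_mem' := by simp
  mul_mem' := by
    intro a b ha hb j v
    rw [map_mul, ← mulVec_mulVec, ha, hb]
  inv_mem' := by
    intro a ha j v
    rw [← ha j, mulVec_mulVec, mat_mul_mat_inv, one_mulVec]

/-- The nilradical `𝔫` of the Lie algebra of the parabolic subgroup `P`, consisting of the
matrices `x` with `x (V (j+1)) ⊆ V j`.  The trace form identifies it with `(𝔰𝔩(n)/𝔭)^*`, the
cotangent space of `SL(n)/P` at the base point. -/
def nilradical (F : PartialFlag n i) : Submodule ℂ (Matrix (Fin n) (Fin n) ℂ) where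
  carrier := {x | ∀ j : Fin m, ∀ v ∈ F.V j.succ, x *ᵥ v ∈ F.V j.castSucc}
  zero_mem' := by simp
  add_mem' := by
    intro a b ha hb j v hv
    rw [add_mulVec]
    exact add_mem (ha j v hv) (hb j v hv)
  smul_mem' := by
    intro c a ha j v hv
    rw [smul_mulVec]
    exact Submodule.smul_mem _ _ (ha j v hv)

/-- The affine variety `SL(n) × 𝔫`. -/
def groupTimesNilradical (F : PartialFlag n i) : FunctionedSpace :=
  FunctionedSpace.affine
    (fun y : SpecialLinearGroup (Fin n) ℂ × F.nilradical =>
      Sum.elim (matrixCoord (mat y.1)) (matrixCoord y.2.1))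

/-- The orbit relation of `P` on `SL(n) × 𝔫`: `(g, x) ∼ (g p, p⁻¹ x p)` for `p ∈ P`. -/
def orbitRel (F : PartialFlag n i) :
    Setoid (SpecialLinearGroup (Fin n) ℂ × F.nilradical) where
  r y z := ∃ p ∈ F.parabolic, z.1 = y.1 * p ∧ z.2.1 = mat p⁻¹ * y.2.1 * mat p
  iseqv :=
    { refl := fun y => ⟨1, one_mem _, by simp, by simp⟩
      symm := by
        rintro y z ⟨p, hp, h1, h2⟩
        refine ⟨p⁻¹, inv_mem hp, by simp [h1], ?_⟩
        rw [h2, inv_inv]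
        calc y.2.1 = (mat p * mat p⁻¹) * y.2.1 * (mat p * mat p⁻¹) := by
                rw [mat_mul_mat_inv, one_mul, mul_one]
          _ = _ := by simp only [Matrix.mul_assoc]
      trans := by
        rintro y z w ⟨p, hp, h1, h2⟩ ⟨q, hq, h3, h4⟩
        refine ⟨p * q, mul_mem hp hq, by rw [h3, h1, mul_assoc], ?_⟩
        rw [h4, h2, _root_.mul_inv_rev, map_mul, map_mul]
        simp only [Matrix.mul_assoc] }

/-- The cotangent bundle `T^*(SL(n)/P)`, as the homogeneous vector bundle `SL(n) ×^P 𝔫`, i.e. the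
quotient variety of `SL(n) × 𝔫` by `P`.  The class of `(g, x)` is the cotangent vector
`φ = g x g⁻¹` at the point `g P` of `SL(n)/P`, that is, at the flag `g V`. -/
def cotangentBundle (F : PartialFlag n i) : FunctionedSpace :=
  F.groupTimesNilradical.quotient F.orbitRel

/-- The Springer map, `(g V, φ) ↦ φ`, that is `[g, x] ↦ g x g⁻¹`, with values in matrices. -/
def springerMap (F : PartialFlag n i) (y : F.cotangentBundle) : Matrix (Fin n) (Fin n) ℂ :=
  Quotient.lift (s := F.orbitRel)
    (fun y : SpecialLinearGroup (Fin n) ℂ × F.nilradical => mat y.1 * y.2.1 * mat y.1⁻¹)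
    (by
      rintro y z ⟨p, hp, h1, h2⟩
      rw [h2, h1, _root_.mul_inv_rev, map_mul, map_mul]
      symm
      calc _ = mat y.1 * (mat p * mat p⁻¹) * y.2.1 * (mat p * mat p⁻¹) * mat y.1⁻¹ := by
                simp only [Matrix.mul_assoc]
        _ = _ := by rw [mat_mul_mat_inv, mul_one, mul_one]) y

end PartialFlag

/-! Passing to orthogonal complements reverses the type of a flag, and the transpose of an element
of the nilradical of a flag lies in the nilradical of the dual flag. Hence (g, x) ↦ (ᵗg⁻¹, ᵗx)
descends to an isomorphism between the cotangent bundles of a flag and of its dual, and it turns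
gxg⁻¹ into its transpose. Each Jordan block is conjugate to its transpose, so transposition
preserves the orbit closure, and it is the automorphism ψ. Since the two flags are arbitrary, the
standard form is replaced by (w, v) ↦ ᵗw h v, where h ∈ SL(n) comes from transitivity on flags
(`exists_isDualPair`); h cancels in `springerMap_dualityIso`.

It remains to see that the Springer maps land in the closure (`conj_mem_zariskiClosure`). For x in
the nilradical, the rank of x^l is at most the number of boxes of the Young diagram outside its
first l columns (`rank_pow_le`), and some y in the nilradical, with a Jordan basis of type d,
attains all these bounds. On the line through x and y, which stays in the nilradical, ranks can only
drop below those of y at finitely many points, so all other points have the ranks of y. A nilpotent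
endomorphism is determined up to conjugacy by the ranks of its powers, and scaling makes the
conjugating matrix an element of SL(n). So the line meets the orbit in all but finitely many points,
and x is in the closure. -/

namespace FunctionedSpace

/-! ### Polynomial maps, affine sets and quotients -/

/-- The algebra of polynomial functions in the coordinates `c`. -/
noncomputable def polynomialFunctions {Y ι : Type} (c : Y → ι → ℂ) : Subalgebra ℂ (Y → ℂ) :=
  (MvPolynomial.aeval fun i y => c y i).range

theorem mem_polynomialFunctions {Y ι : Type} {c : Y → ι → ℂ} {u : Y → ℂ} :
    u ∈ polynomialFunctions c ↔ ∃ p : MvPolynomial ι ℂ, ∀ y, u y = MvPolynomial.eval (c y) p := by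
  have key : ∀ (p : MvPolynomial ι ℂ) (y : Y),
      (MvPolynomial.aeval (fun i y => c y i) p : Y → ℂ) y = MvPolynomial.eval (c y) p := by
    intro p y
    induction p using MvPolynomial.induction_on with
    | C a => simp
    | add p q hp hq => simp [hp, hq]
    | mul_X p i hp => simp [hp]
  constructor
  · rintro ⟨p, rfl⟩
    exact ⟨p, key p⟩
  · rintro ⟨p, hp⟩
    exact ⟨p, funext fun y => (key p y).trans (hp y).symm⟩

theorem coord_mem_polynomialFunctions {Y ι : Type} (c : Y → ι → ℂ) (i : ι) :
    (fun y => c y i) ∈ polynomialFunctions c :=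
  mem_polynomialFunctions.2 ⟨MvPolynomial.X i, fun y => by simp⟩

/-- A map between affine sets whose coordinates are polynomials is a morphism. -/
theorem isMorphism_affine {Y Z ι κ : Type} {c : Y → ι → ℂ} {e : Z → κ → ℂ} (f : Y → Z)
    (hf : ∀ k, (fun y => e (f y) k) ∈ polynomialFunctions c) :
    IsMorphism (affine c) (affine e) f := by
  simp only [mem_polynomialFunctions] at hf
  choose P hP using hf
  have hev : ∀ (p : MvPolynomial κ ℂ) (y : Y),
      MvPolynomial.eval (e (f y)) p = MvPolynomial.eval (c y) (MvPolynomial.bind₁ P p) := by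
    intro p y
    rw [MvPolynomial.eval, MvPolynomial.eval, MvPolynomial.eval₂Hom_bind₁]
    congr 2
    exact funext fun k => hP k y
  have hcont : @Continuous Y Z (zariski c) (zariski e) f := by
    let := zariski c
    rw [continuous_generateFrom_iff]
    rintro _ ⟨p, rfl⟩
    refine isOpen_generateFrom_of_mem ⟨MvPolynomial.bind₁ P p, ?_⟩
    ext y
    simp [hev]
  refine ⟨hcont, fun U u hu x => ?_⟩
  obtain ⟨p, q, V, hV, h⟩ := hu ⟨f x.1, x.2⟩
  refine ⟨MvPolynomial.bind₁ P p, MvPolynomial.bind₁ P q,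
    @Opens.comap _ _ (zariski c) (zariski e) (@ContinuousMap.mk _ _ (zariski c) (zariski e) f hcont)
      V, hV, fun y hy => ?_⟩
  rw [← hev, ← hev]
  exact h ⟨f y.1, y.2⟩ hy

theorem isMorphism_mk (X : FunctionedSpace) (r : Setoid X) :
    IsMorphism X (X.quotient r) (Quotient.mk r) :=
  ⟨continuous_quotient_mk', fun _ _ hu => hu⟩

/-- The universal property of the quotient. -/
theorem isMorphism_of_comp_mk {X Z : FunctionedSpace} {r : Setoid X} {f : X.quotient r → Z}
    (hf : IsMorphism X Z fun x => f (Quotient.mk r x)) : IsMorphism (X.quotient r) Z f := by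
  obtain ⟨hc, h⟩ := hf
  exact ⟨isQuotientMap_quotient_mk'.continuous_iff.2 hc, fun U u hu => h U u hu⟩

end FunctionedSpace

/-! ### Matrices with polynomial entries -/

section Matrices

open FunctionedSpace Matrix

variable {Y ι : Type} {c : Y → ι → ℂ} {l m n : Type}

/-- A matrix-valued function whose entries are polynomial in the coordinates `c`. -/
def IsPolynomialMatrix (c : Y → ι → ℂ) (A : Y → Matrix l m ℂ) : Prop :=
  ∀ a b, (fun y => A y a b) ∈ polynomialFunctions c

theorem IsPolynomialMatrix.const (A : Matrix l m ℂ) : IsPolynomialMatrix c fun _ => A :=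
  fun a b => Subalgebra.algebraMap_mem (polynomialFunctions c) (A a b)

theorem IsPolynomialMatrix.mul [Fintype m] {A : Y → Matrix l m ℂ} {B : Y → Matrix m n ℂ}
    (hA : IsPolynomialMatrix c A) (hB : IsPolynomialMatrix c B) :
    IsPolynomialMatrix c fun y => A y * B y := by
  intro a b
  convert sum_mem fun j (_ : j ∈ Finset.univ) => mul_mem (hA a j) (hB j b) using 1
  ext y
  simp [Matrix.mul_apply]

theorem IsPolynomialMatrix.transpose {A : Y → Matrix l m ℂ} (hA : IsPolynomialMatrix c A) :
    IsPolynomialMatrix c fun y => (A y)ᵀ :=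
  fun a b => hA b a

theorem IsPolynomialMatrix.det [Fintype m] [DecidableEq m] {A : Y → Matrix m m ℂ}
    (hA : IsPolynomialMatrix c A) : (fun y => (A y).det) ∈ polynomialFunctions c := by
  convert sum_mem fun τ (_ : τ ∈ (Finset.univ : Finset (Equiv.Perm m))) =>
    Subalgebra.smul_mem _ (prod_mem fun j (_ : j ∈ Finset.univ) => hA (τ j) j)
      ((Equiv.Perm.sign τ : ℤ) : ℂ) using 1
  ext y
  simp [Matrix.det_apply, Units.smul_def]

theorem IsPolynomialMatrix.adjugate [Fintype m] [DecidableEq m] {A : Y → Matrix m m ℂ}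
    (hA : IsPolynomialMatrix c A) : IsPolynomialMatrix c fun y => (A y).adjugate := by
  intro a b
  simp only [Matrix.adjugate_apply]
  refine IsPolynomialMatrix.det fun i j => ?_
  by_cases h : i = b
  · subst h
    simp only [Matrix.updateRow_self]
    exact Subalgebra.algebraMap_mem (polynomialFunctions c) ((Pi.single a 1 : m → ℂ) j)
  · simpa [Matrix.updateRow_ne h] using hA i j

/-- On SL(n) the inverse is the adjugate, so no denominators occur. -/
theorem IsPolynomialMatrix.mat_inv {n : ℕ} {g : Y → Matrix.SpecialLinearGroup (Fin n) ℂ}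
    (hg : IsPolynomialMatrix c fun y => mat (g y)) :
    IsPolynomialMatrix c fun y => mat (g y)⁻¹ := by
  have : ∀ y, mat (g y)⁻¹ = (mat (g y)).adjugate := fun y => Matrix.SpecialLinearGroup.coe_inv (g y)
  simpa only [this] using hg.adjugate

end Matrices

/-! ### Nilpotent endomorphisms are classified by the ranks of their powers -/

section NilpotentEndomorphisms

open Module

variable {K : Type} [Field K]

/-- An injective linear map on a subspace extends to an isomorphism between spaces of the same
dimension. -/
theorem exists_linearEquiv_extend {E E' : Type} [AddCommGroup E] [Module K E] [FiniteDimensional K E]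
    [AddCommGroup E'] [Module K E'] [FiniteDimensional K E'] (h : finrank K E = finrank K E')
    (p : Submodule K E) (φ : p →ₗ[K] E') (hφ : Function.Injective φ) :
    ∃ ε : E ≃ₗ[K] E', ∀ v : p, ε v = φ v := by
  obtain ⟨q, hq⟩ := p.exists_isCompl
  obtain ⟨q', hq'⟩ := (LinearMap.range φ).exists_isCompl
  have h1 := Submodule.finrank_add_eq_of_isCompl hq
  have h2 := Submodule.finrank_add_eq_of_isCompl hq'
  have h3 := LinearMap.finrank_range_of_inj hφ
  let ψ : q ≃ₗ[K] q' := LinearEquiv.ofFinrankEq q q' (by omega)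
  refine ⟨(p.prodEquivOfIsCompl q hq).symm ≪≫ₗ ((LinearEquiv.ofInjective φ hφ).prodCongr ψ) ≪≫ₗ
    (LinearMap.range φ).prodEquivOfIsCompl q' hq', fun v => ?_⟩
  simp

/-- The restriction of an endomorphism to its range. -/
def restrictRange {V : Type} [AddCommGroup V] [Module K V] (T : End K V) :
    End K (LinearMap.range T) :=
  T.restrict fun v _ => LinearMap.mem_range_self T v

theorem coe_restrictRange_pow {V : Type} [AddCommGroup V] [Module K V] (T : End K V) (l : ℕ)
    (w : LinearMap.range T) : ((restrictRange T ^ l) w : V) = (T ^ l) w := by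
  rw [restrictRange, Module.End.pow_restrict]
  rfl

/-- Restriction to the range shifts the rank sequence by one, so equality of rank sequences is
inherited in the induction on dimension. -/
theorem finrank_range_restrictRange_pow {V : Type} [AddCommGroup V] [Module K V] (T : End K V)
    (l : ℕ) : finrank K (LinearMap.range (restrictRange T ^ l)) =
      finrank K (LinearMap.range (T ^ (l + 1))) := by
  rw [← Submodule.finrank_map_subtype_eq]
  have : (LinearMap.range (restrictRange T ^ l)).map (LinearMap.range T).subtype =
      LinearMap.range (T ^ (l + 1)) := ?_
  · rw [this]
  ext v
  simp only [Submodule.mem_map, LinearMap.mem_range, Submodule.subtype_apply]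
  constructor
  · rintro ⟨_, ⟨⟨_, u, rfl⟩, rfl⟩, rfl⟩
    exact ⟨u, by rw [coe_restrictRange_pow, pow_succ]; rfl⟩
  · rintro ⟨u, rfl⟩
    exact ⟨_, ⟨⟨T u, u, rfl⟩, rfl⟩, by rw [coe_restrictRange_pow, pow_succ]; rfl⟩

theorem isNilpotent_restrictRange {V : Type} [AddCommGroup V] [Module K V] {T : End K V}
    (hT : IsNilpotent T) : IsNilpotent (restrictRange T) := by
  obtain ⟨l, hl⟩ := hT
  refine ⟨l, LinearMap.ext fun w => Subtype.ext ?_⟩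
  rw [coe_restrictRange_pow, hl]
  rfl

/-- An intertwining isomorphism between the ranges of two endomorphisms extends to the whole
spaces. -/
theorem exists_intertwining_extend {V V' : Type} [AddCommGroup V] [Module K V]
    [FiniteDimensional K V] [AddCommGroup V'] [Module K V'] [FiniteDimensional K V']
    (hV : finrank K V = finrank K V') (T : End K V) (T' : End K V')
    (e : LinearMap.range T ≃ₗ[K] LinearMap.range T')
    (he : ∀ w, e (restrictRange T w) = restrictRange T' (e w)) :
    ∃ e : V ≃ₗ[K] V', ∀ v, e (T v) = T' (e v) := by
  obtain ⟨s, hs⟩ := T'.rangeRestrict.exists_rightInverse_of_surjective T'.range_rangeRestrict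
  have hs' : ∀ w, T' (s w) = w := fun w => congrArg Subtype.val (LinearMap.congr_fun hs w)
  -- A first approximation: f satisfies T' ∘ f = e ∘ T and kills ker T, but it need not extend e or
  -- be injective. It will be corrected by a map g into ker T', which does not affect the relation.
  let f : V →ₗ[K] V' := s ∘ₗ e.toLinearMap ∘ₗ T.rangeRestrict
  have hf : ∀ v, T' (f v) = e ⟨T v, v, rfl⟩ := fun v => hs' _
  have hf0 : ∀ v, T v = 0 → f v = 0 := by
    intro v hv
    have : T.rangeRestrict v = 0 := Subtype.ext hv
    simp [f, this]
  have he' : ∀ w, (e (restrictRange T w) : V') = T' (e w) := fun w => congrArg Subtype.val (he w)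
  have hker : finrank K (LinearMap.ker T) = finrank K (LinearMap.ker T') := by
    have h1 := T.finrank_range_add_finrank_ker
    have h2 := T'.finrank_range_add_finrank_ker
    have h3 := e.finrank_eq
    omega
  -- On ker T ∩ range T the map e takes values in ker T'. As the kernels have equal dimension, this
  -- restriction extends to an isomorphism ε of kernels.
  let ι : (LinearMap.range T).comap (LinearMap.ker T).subtype →ₗ[K] LinearMap.range T :=
    ((LinearMap.ker T).subtype ∘ₗ Submodule.subtype _).codRestrict _ fun v => v.2
  let φ : (LinearMap.range T).comap (LinearMap.ker T).subtype →ₗ[K] LinearMap.ker T' :=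
    ((LinearMap.range T').subtype ∘ₗ e.toLinearMap ∘ₗ ι).codRestrict _ fun v => by
      have h1 : T' (e (ι v)) = e (restrictRange T (ι v)) := (he' _).symm
      have h2 : restrictRange T (ι v) = 0 := Subtype.ext v.1.2
      rw [h2, map_zero] at h1
      exact h1
  have hφ : Function.Injective φ := by
    intro a b hab
    have h1 : (e (ι a) : V') = e (ι b) := congrArg (fun z : LinearMap.ker T' => (z : V')) hab
    have h2 := congrArg (fun z : LinearMap.range T => (z : V)) (e.injective (Subtype.ext h1))
    exact Subtype.ext (Subtype.ext h2)
  obtain ⟨ε, hε⟩ := exists_linearEquiv_extend hker _ φ hφ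
  -- The correction is prescribed as e - f on range T and as ε on ker T. The two agree on the
  -- intersection because f vanishes there, so they glue and then extend to V.
  let δ₁ : V →ₗ.[K] LinearMap.ker T' :=
    ⟨LinearMap.range T, LinearMap.codRestrict _
      ((LinearMap.range T').subtype ∘ₗ e.toLinearMap - f ∘ₗ (LinearMap.range T).subtype) (by
        intro w
        rw [LinearMap.mem_ker, LinearMap.sub_apply, map_sub, sub_eq_zero]
        exact (he' w).symm.trans (hf w).symm)⟩
  let δ₂ : V →ₗ.[K] LinearMap.ker T' := ⟨LinearMap.ker T, ε.toLinearMap⟩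
  have hδ : ∀ (x : δ₁.domain) (y : δ₂.domain), (x : V) = y → δ₁ x = δ₂ y := by
    rintro ⟨x, hx⟩ ⟨y, hy⟩ (rfl : x = y)
    refine Subtype.ext ?_
    have h1 : ((ε ⟨x, hy⟩ : LinearMap.ker T') : V') = e ⟨x, hx⟩ :=
      congrArg Subtype.val (hε ⟨⟨x, hy⟩, hx⟩)
    have h2 : ((δ₁ ⟨x, hx⟩ : LinearMap.ker T') : V') = e ⟨x, hx⟩ - f x := rfl
    rw [h2, hf0 x hy, sub_zero, ← h1]
    rfl
  obtain ⟨g, hg⟩ := (δ₁.sup δ₂ hδ).toFun.exists_extend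
  have hg1 : ∀ w : LinearMap.range T, (g w : V') = e w - f w := by
    intro w
    have h1 : δ₁ w = (δ₁.sup δ₂ hδ) ⟨w, le_sup_left (a := δ₁.domain) w.2⟩ :=
      (LinearPMap.left_le_sup δ₁ δ₂ hδ).2 rfl
    have h2 := LinearMap.congr_fun hg ⟨w, le_sup_left (a := δ₁.domain) w.2⟩
    exact congrArg Subtype.val (h2.trans h1.symm)
  have hg2 : ∀ w : LinearMap.ker T, g w = ε w := by
    intro w
    have h1 : δ₂ w = (δ₁.sup δ₂ hδ) ⟨w, le_sup_right (b := δ₂.domain) w.2⟩ :=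
      (LinearPMap.right_le_sup δ₁ δ₂ hδ).2 rfl
    have h2 := LinearMap.congr_fun hg ⟨w, le_sup_right (b := δ₂.domain) w.2⟩
    exact h2.trans h1.symm
  let E : V →ₗ[K] V' := f + (LinearMap.ker T').subtype ∘ₗ g
  have hE : ∀ v, E v = f v + g v := fun v => rfl
  have hTE : ∀ v, T' (E v) = e ⟨T v, v, rfl⟩ := by
    intro v
    rw [hE, map_add, hf, LinearMap.mem_ker.1 (g v).2, add_zero]
  -- If E v = 0, then e (T v) = T' (E v) = 0, so v ∈ ker T, where E is the injective map ε.
  have hinj : Function.Injective E := by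
    refine (injective_iff_map_eq_zero E).2 fun v hv => ?_
    have h1 := hTE v
    rw [hv, map_zero] at h1
    have h2 : T v = 0 :=
      congrArg Subtype.val (e.map_eq_zero_iff.1 (Subtype.ext h1.symm))
    have h3 := hE v
    rw [hv, hf0 v h2, zero_add, hg2 ⟨v, h2⟩] at h3
    exact congrArg Subtype.val (ε.map_eq_zero_iff.1 (Subtype.ext h3.symm))
  refine ⟨LinearMap.linearEquivOfInjective E hinj hV, fun v => ?_⟩
  have h1 : E (T v) = e ⟨T v, v, rfl⟩ := by
    rw [hE, hg1 ⟨T v, v, rfl⟩]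
    abel
  exact h1.trans (hTE v).symm

/-- Two nilpotent endomorphisms all of whose powers have the same ranks are conjugate. -/
theorem exists_intertwining_of_finrank_range_pow_eq (N : ℕ) : ∀ {V V' : Type} [AddCommGroup V]
    [Module K V] [FiniteDimensional K V] [AddCommGroup V'] [Module K V'] [FiniteDimensional K V']
    (T : End K V) (T' : End K V'), finrank K V = N → IsNilpotent T → IsNilpotent T' →
    (∀ l, finrank K (LinearMap.range (T ^ l)) = finrank K (LinearMap.range (T' ^ l))) →
    ∃ e : V ≃ₗ[K] V', ∀ v, e (T v) = T' (e v) := by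
  induction N using Nat.strong_induction_on with
  | _ N ih =>
    intro V V' _ _ _ _ _ _ T T' hN hT hT' h
    have hV : finrank K V = finrank K V' := by
      have h0 := h 0
      rwa [pow_zero, pow_zero, Module.End.one_eq_id, Module.End.one_eq_id, LinearMap.range_id, LinearMap.range_id,
        finrank_top, finrank_top] at h0
    by_cases hlt : finrank K (LinearMap.range T) < N
    · obtain ⟨e, he⟩ := ih _ hlt (restrictRange T) (restrictRange T') rfl
        (isNilpotent_restrictRange hT) (isNilpotent_restrictRange hT')
        (fun l => by simpa only [finrank_range_restrictRange_pow] using h (l + 1))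
      exact exists_intertwining_extend hV T T' e he
    -- The induction stops when T is surjective; being also nilpotent, it then lives on the zero
    -- space.
    · have htop : LinearMap.range T = ⊤ := by
        refine Submodule.eq_top_of_finrank_eq ?_
        have := LinearMap.finrank_range_le T
        omega
      obtain ⟨l, hl⟩ := hT
      have hsub : Subsingleton V := by
        have h1 : Function.Surjective (T ^ l) := by
          rw [Module.End.coe_pow]
          exact (LinearMap.range_eq_top.1 htop).iterate l
        rw [hl] at h1
        refine subsingleton_of_forall_eq 0 fun v => ?_
        obtain ⟨u, rfl⟩ := h1 v
        rfl
      let e := LinearEquiv.ofFinrankEq V V' hV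
      have := e.symm.toEquiv.subsingleton
      exact ⟨e, fun v => Subsingleton.elim _ _⟩

end NilpotentEndomorphisms

/-! ### Flags: adapted bases, transitivity of SL(n), duality -/

open Module in
/-- Over `ℂ`, every linear automorphism of `ℂⁿ` is a multiple of an element of `SL(n)`. -/
theorem exists_mat_eq_smul {n : ℕ} (e : (Fin n → ℂ) ≃ₗ[ℂ] (Fin n → ℂ)) :
    ∃ (g : Matrix.SpecialLinearGroup (Fin n) ℂ) (c : ℂ), c ≠ 0 ∧
      mat g = c • LinearMap.toMatrix' e.toLinearMap := by
  have hdet : (LinearMap.toMatrix' e.toLinearMap).det ≠ 0 := by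
    rw [LinearMap.det_toMatrix']
    exact (LinearEquiv.isUnit_det' e).ne_zero
  obtain ⟨c, hc0, hc⟩ : ∃ c : ℂ, c ≠ 0 ∧ c ^ n * (LinearMap.toMatrix' e.toLinearMap).det = 1 := by
    rcases Nat.eq_zero_or_pos n with rfl | hn
    · exact ⟨1, one_ne_zero, by rw [Matrix.det_isEmpty, pow_zero, one_mul]⟩
    · obtain ⟨c, hc⟩ := IsAlgClosed.exists_pow_nat_eq (LinearMap.toMatrix' e.toLinearMap).det⁻¹ hn
      refine ⟨c, fun h => ?_, by rw [hc, inv_mul_cancel₀ hdet]⟩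
      rw [h, zero_pow hn.ne'] at hc
      exact inv_ne_zero hdet hc.symm
  exact ⟨⟨c • LinearMap.toMatrix' e.toLinearMap, by simpa using hc⟩, c, hc0, rfl⟩

theorem mat_inv_mul_mat {n : ℕ} (g : Matrix.SpecialLinearGroup (Fin n) ℂ) :
    mat g⁻¹ * mat g = 1 := by
  rw [← map_mul, inv_mul_cancel, map_one]

namespace PartialFlag

open Matrix Module

variable {n m : ℕ} {i : Fin m → ℕ}

theorem filter_castSucc_lt_succ (j : Fin m) :
    (Finset.univ.filter fun a : Fin m => a.castSucc < j.succ) =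
      insert j (Finset.univ.filter fun a : Fin m => a.castSucc < j.castSucc) := by
  ext a
  simp only [Finset.mem_filter, Finset.mem_univ, true_and, Finset.mem_insert,
    Fin.castSucc_lt_succ_iff, Fin.castSucc_lt_castSucc_iff, le_iff_eq_or_lt]

theorem finrank_V (F : PartialFlag n i) (j : Fin (m + 1)) :
    finrank ℂ (F.V j) = ∑ a with a.castSucc < j, i a := by
  induction j using Fin.induction with
  | zero => simp [F.bot]
  | succ j ih =>
    rw [F.dim, ih, filter_castSucc_lt_succ, Finset.sum_insert (by simp), add_comm]

theorem sum_type (F : PartialFlag n i) : ∑ a, i a = n := by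
  have h := F.finrank_V (Fin.last m)
  rw [F.top, finrank_top] at h
  simpa [Fin.castSucc_lt_last] using h.symm

/-- A flag has a basis adapted to it. -/
theorem exists_adapted_basis (F : PartialFlag n i) :
    ∃ b : Basis (Σ j, Fin (i j)) ℂ (Fin n → ℂ),
      ∀ j, F.V j = Submodule.span ℂ (b '' {p | p.1.castSucc < j}) := by
  have hW : ∀ j : Fin m, ∃ W : Submodule ℂ (Fin n → ℂ),
      F.V j.castSucc ⊔ W = F.V j.succ ∧ finrank ℂ W = i j := by
    intro j
    -- By the modular law, a complement of the smaller step intersected with the larger step is a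
    -- complement inside the larger step.
    obtain ⟨C, hC⟩ := (F.V j.castSucc).exists_isCompl
    have hle : F.V j.castSucc ≤ F.V j.succ := F.mono j.castSucc_le_succ
    have hsup : F.V j.castSucc ⊔ (C ⊓ F.V j.succ) = F.V j.succ := by
      rw [← sup_inf_assoc_of_le _ hle, hC.sup_eq_top, top_inf_eq]
    refine ⟨_, hsup, ?_⟩
    have h := Submodule.finrank_sup_add_finrank_inf_eq (F.V j.castSucc) (C ⊓ F.V j.succ)
    rw [hsup, ← inf_assoc, hC.inf_eq_bot, bot_inf_eq, finrank_bot, F.dim] at h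
    omega
  choose W hsup hrank using hW
  let w : ∀ j, Basis (Fin (i j)) ℂ (W j) := fun j => finBasisOfFinrankEq ℂ (W j) (hrank j)
  let u : (Σ j, Fin (i j)) → Fin n → ℂ := fun p => w p.1 p.2
  have hspan : ∀ j, Submodule.span ℂ (u '' {p | p.1.castSucc < j}) = F.V j := by
    intro j
    induction j using Fin.induction with
    | zero => simp [F.bot]
    | succ j ih =>
      have hset : {p : Σ j, Fin (i j) | p.1.castSucc < j.succ} =
          {p | p.1.castSucc < j.castSucc} ∪ Set.range (Sigma.mk j) := by
        ext ⟨a, c⟩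
        have : a.castSucc < j.succ ↔ a.castSucc < j.castSucc ∨ j = a := by
          rw [Fin.castSucc_lt_succ_iff, Fin.castSucc_lt_castSucc_iff, le_iff_lt_or_eq, eq_comm]
        simp only [Set.mem_ofPred_eq, Set.mem_union, this, Set.mem_range]
        refine or_congr_right ⟨?_, ?_⟩
        · rintro rfl
          exact ⟨c, rfl⟩
        · rintro ⟨_, h⟩
          exact congrArg Sigma.fst h
      have hW' : Submodule.span ℂ (u '' Set.range (Sigma.mk j)) = W j := by
        have h : u '' Set.range (Sigma.mk j) = (W j).subtype '' Set.range (w j) := by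
          rw [← Set.range_comp, ← Set.range_comp]
          rfl
        rw [h, ← Submodule.map_span, (w j).span_eq, Submodule.map_top, Submodule.range_subtype]
      rw [hset, Set.image_union, Submodule.span_union, ih, hW', hsup]
  have htop : ⊤ ≤ Submodule.span ℂ (Set.range u) := by
    rw [← F.top, ← hspan]
    exact Submodule.span_mono (Set.image_subset_range _ _)
  refine ⟨basisOfTopLeSpanOfCardEqFinrank u htop (by simp [F.sum_type]), fun j => ?_⟩
  rw [coe_basisOfTopLeSpanOfCardEqFinrank, hspan]

/-- `SL(n)` acts transitively on the flags of a given type. -/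
theorem exists_mat_mulVec_mem_iff (F G : PartialFlag n i) :
    ∃ g : SpecialLinearGroup (Fin n) ℂ, ∀ j v, v ∈ F.V j ↔ mat g *ᵥ v ∈ G.V j := by
  obtain ⟨b, hb⟩ := F.exists_adapted_basis
  obtain ⟨b', hb'⟩ := G.exists_adapted_basis
  let e := b.equiv b' (Equiv.refl _)
  -- Rescaling into SL(n) is harmless, since subspaces are stable under nonzero scalars.
  obtain ⟨g, c, hc, hg⟩ := exists_mat_eq_smul e
  have hmap : ∀ j, G.V j = (F.V j).map e.toLinearMap := by
    intro j
    rw [hb, hb', Submodule.map_span, ← Set.image_comp]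
    congr 1
    refine Set.image_congr fun p _ => ?_
    simp [e]
  refine ⟨g, fun j v => ?_⟩
  rw [hg, smul_mulVec, Submodule.smul_mem_iff _ hc, LinearMap.toMatrix'_mulVec, hmap]
  refine ⟨fun h => ⟨v, h, rfl⟩, ?_⟩
  rintro ⟨u, hu, h⟩
  rwa [← e.injective h]

/-- The standard symmetric bilinear form on `ℂⁿ`. -/
noncomputable def dotForm (n : ℕ) : LinearMap.BilinForm ℂ (Fin n → ℂ) :=
  Matrix.toBilin' 1

theorem dotForm_apply (v w : Fin n → ℂ) : dotForm n v w = v ⬝ᵥ w := by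
  simp [dotForm, Matrix.toBilin'_apply']

theorem dotForm_nondegenerate : (dotForm n).Nondegenerate :=
  LinearMap.BilinForm.nondegenerate_toBilin'_of_det_ne_zero' _ (by simp)

theorem dotForm_isRefl : (dotForm n).IsRefl := fun v w h => by
  rwa [dotForm_apply, dotProduct_comm, ← dotForm_apply]

/-- The dual flag, consisting of the orthogonal complements. -/
noncomputable def dual (F : PartialFlag n i) : PartialFlag n (fun j => i (Fin.rev j)) where
  V j := (dotForm n).orthogonal (F.V (Fin.rev j))
  mono _ _ h := LinearMap.BilinForm.orthogonal_le (F.mono (Fin.rev_le_rev.2 h))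
  bot := by
    rw [Fin.rev_zero, F.top]
    exact LinearMap.BilinForm.orthogonal_top_eq_bot dotForm_nondegenerate
  top := by
    rw [Fin.rev_last, F.bot]
    exact LinearMap.BilinForm.orthogonal_bot
  dim j := by
    rw [LinearMap.BilinForm.finrank_orthogonal dotForm_nondegenerate,
      LinearMap.BilinForm.finrank_orthogonal dotForm_nondegenerate, Fin.rev_succ, Fin.rev_castSucc,
      F.dim]
    have := (F.V (Fin.rev j).succ).finrank_le
    rw [F.dim] at this
    omega

theorem mem_dual_V (F : PartialFlag n i) (j : Fin (m + 1)) (w : Fin n → ℂ) :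
    w ∈ F.dual.V j ↔ ∀ v ∈ F.V (Fin.rev j), v ⬝ᵥ w = 0 := by
  simp only [dual, LinearMap.BilinForm.mem_orthogonal_iff, dotForm_apply]

theorem mem_V_iff_dual (F : PartialFlag n i) (j : Fin (m + 1)) (v : Fin n → ℂ) :
    v ∈ F.V j ↔ ∀ w ∈ F.dual.V (Fin.rev j), w ⬝ᵥ v = 0 := by
  rw [← LinearMap.BilinForm.orthogonal_orthogonal dotForm_nondegenerate dotForm_isRefl (F.V j),
    LinearMap.BilinForm.mem_orthogonal_iff]
  simp only [dual, dotForm_apply, Fin.rev_rev]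

/-- The flags `F` and `G` are dual to each other for the bilinear form `(w, v) ↦ ᵗw h v`. -/
def IsDualPair {i' : Fin m → ℕ} (h : SpecialLinearGroup (Fin n) ℂ) (F : PartialFlag n i)
    (G : PartialFlag n i') : Prop :=
  ∀ j v, v ∈ F.V j ↔ ∀ w ∈ G.V (Fin.rev j), w ⬝ᵥ mat h *ᵥ v = 0

theorem dotProduct_transpose_mulVec (A : Matrix (Fin n) (Fin n) ℂ) (v w : Fin n → ℂ) :
    v ⬝ᵥ Aᵀ *ᵥ w = w ⬝ᵥ A *ᵥ v := by
  rw [mulVec_transpose, dotProduct_comm, dotProduct_mulVec]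

theorem mat_transpose (h : SpecialLinearGroup (Fin n) ℂ) : mat h.transpose = (mat h)ᵀ := rfl

/-- Take h carrying `F` to the orthogonal flag of `G`. Both directions are recorded so that the
duality isomorphism and its inverse come from the same construction, with h replaced by its
transpose. -/
theorem exists_isDualPair (G : PartialFlag n i) (F : PartialFlag n (fun j => i (Fin.rev j))) :
    ∃ h : SpecialLinearGroup (Fin n) ℂ, IsDualPair h F G ∧ IsDualPair h.transpose G F := by
  obtain ⟨h, hh⟩ := F.exists_mat_mulVec_mem_iff G.dual
  refine ⟨h, fun j v => by rw [hh, mem_dual_V], fun j w => ?_⟩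
  rw [mem_V_iff_dual]
  constructor
  · intro H v hv
    rw [mat_transpose, dotProduct_transpose_mulVec, dotProduct_comm]
    exact H _ ((hh _ _).1 hv)
  · intro H u hu
    have hu' : mat h *ᵥ (mat h⁻¹ *ᵥ u) = u := by
      rw [mulVec_mulVec, mat_mul_mat_inv, one_mulVec]
    have := H (mat h⁻¹ *ᵥ u) ((hh _ _).2 (by rwa [hu']))
    rwa [mat_transpose, dotProduct_transpose_mulVec, hu', dotProduct_comm] at this

end PartialFlag

/-! ### The duality isomorphism of cotangent bundles -/

namespace PartialFlag

open Matrix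

variable {n m : ℕ} {i i' : Fin m → ℕ}

section Duality

variable {h : SpecialLinearGroup (Fin n) ℂ} {F : PartialFlag n i} {G : PartialFlag n i'}

/-- ᵗ(h x h⁻¹) is the adjoint of x for the form ᵗw h v, and the adjoint of a map lowering a flag by
one step lowers the dual flag by one step. -/
theorem IsDualPair.conj_transpose_mem_nilradical (hFG : IsDualPair h F G)
    (hGF : IsDualPair h.transpose G F) {x : Matrix (Fin n) (Fin n) ℂ} (hx : x ∈ F.nilradical) :
    (mat h * x * mat h⁻¹)ᵀ ∈ G.nilradical := by
  intro j w hw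
  rw [hGF]
  intro v hv
  have h1 := hx (Fin.rev j) v (by rwa [Fin.rev_castSucc] at hv)
  rw [← Fin.rev_succ, hFG, Fin.rev_rev] at h1
  rw [mat_transpose, mulVec_mulVec, ← transpose_mul, dotProduct_transpose_mulVec,
    Matrix.mul_assoc, mat_inv_mul_mat, mul_one, ← mulVec_mulVec]
  exact h1 w hw

/-- The transpose inverse. -/
def transposeInv (g : SpecialLinearGroup (Fin n) ℂ) : SpecialLinearGroup (Fin n) ℂ :=
  g⁻¹.transpose

theorem mat_transposeInv (g : SpecialLinearGroup (Fin n) ℂ) : mat (transposeInv g) = (mat g⁻¹)ᵀ :=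
  rfl

theorem mat_injective : Function.Injective (mat (n := n)) := Subtype.val_injective

theorem transposeInv_mul (a b : SpecialLinearGroup (Fin n) ℂ) :
    transposeInv (a * b) = transposeInv a * transposeInv b :=
  mat_injective (by
    rw [map_mul, mat_transposeInv, mat_transposeInv, mat_transposeInv, _root_.mul_inv_rev, map_mul,
      transpose_mul])

theorem transposeInv_inv (a : SpecialLinearGroup (Fin n) ℂ) :
    transposeInv a⁻¹ = (transposeInv a)⁻¹ := by
  refine eq_inv_of_mul_eq_one_left ?_
  rw [← transposeInv_mul, inv_mul_cancel]
  exact mat_injective (by rw [mat_transposeInv, inv_one, map_one, transpose_one])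

theorem mat_transposeInv_inv (g : SpecialLinearGroup (Fin n) ℂ) :
    mat (transposeInv g)⁻¹ = (mat g)ᵀ := by
  rw [← transposeInv_inv, mat_transposeInv, inv_inv]

theorem transposeInv_transposeInv (a : SpecialLinearGroup (Fin n) ℂ) :
    transposeInv (transposeInv a) = a :=
  mat_injective (by rw [mat_transposeInv, mat_transposeInv_inv, transpose_transpose])

theorem transpose_inv_eq (a : SpecialLinearGroup (Fin n) ℂ) :
    (a.transpose)⁻¹ = transposeInv a := by
  rw [← inv_inv (transposeInv a), ← transposeInv_inv, transposeInv, inv_inv]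

/-- ᵗ(h p h⁻¹)⁻¹ is the contragredient of p: acting by it on w and by p on v leaves ᵗw h v
unchanged, so it stabilizes the dual flag when p stabilizes the flag. -/
theorem IsDualPair.transposeInv_conj_mem_parabolic (hGF : IsDualPair h.transpose G F)
    {p : SpecialLinearGroup (Fin n) ℂ} (hp : p ∈ F.parabolic) :
    transposeInv (h * p * h⁻¹) ∈ G.parabolic := by
  have key : ∀ v w, v ⬝ᵥ mat h.transpose *ᵥ (mat (transposeInv (h * p * h⁻¹)) *ᵥ w) =
      (mat p⁻¹ *ᵥ v) ⬝ᵥ mat h.transpose *ᵥ w := by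
    intro v w
    have h1 : (h * p * h⁻¹)⁻¹ * h = h * p⁻¹ := by group
    rw [mulVec_mulVec, mat_transposeInv, mat_transpose, ← transpose_mul, ← map_mul, h1, map_mul,
      dotProduct_transpose_mulVec, dotProduct_transpose_mulVec, mulVec_mulVec]
  intro j w
  rw [hGF, hGF]
  constructor
  · intro H v hv
    have h1 := H (mat p *ᵥ v) ((hp _ v).2 hv)
    rwa [key, mulVec_mulVec, mat_inv_mul_mat, one_mulVec] at h1
  · intro H v hv
    rw [key]
    exact H _ ((inv_mem hp _ v).2 hv)

/-- The map `(g, x) ↦ (ᵗ(g h⁻¹)⁻¹, ᵗ(h x h⁻¹))`, on the products `SL(n) × 𝔫`. -/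
def dualityMap (hFG : IsDualPair h F G) (hGF : IsDualPair h.transpose G F)
    (y : SpecialLinearGroup (Fin n) ℂ × F.nilradical) :
    SpecialLinearGroup (Fin n) ℂ × G.nilradical :=
  (transposeInv (y.1 * h⁻¹),
    ⟨(mat h * y.2.1 * mat h⁻¹)ᵀ, hFG.conj_transpose_mem_nilradical hGF y.2.2⟩)

theorem isPolynomialMatrix_fst (F : PartialFlag n i) :
    IsPolynomialMatrix (fun y : SpecialLinearGroup (Fin n) ℂ × F.nilradical =>
      Sum.elim (matrixCoord (mat y.1)) (matrixCoord y.2.1)) fun y => mat y.1 :=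
  fun a b => FunctionedSpace.coord_mem_polynomialFunctions _ (Sum.inl (a, b))

theorem isPolynomialMatrix_snd (F : PartialFlag n i) :
    IsPolynomialMatrix (fun y : SpecialLinearGroup (Fin n) ℂ × F.nilradical =>
      Sum.elim (matrixCoord (mat y.1)) (matrixCoord y.2.1)) fun y => y.2.1 :=
  fun a b => FunctionedSpace.coord_mem_polynomialFunctions _ (Sum.inr (a, b))

theorem isMorphism_dualityMap (hFG : IsDualPair h F G) (hGF : IsDualPair h.transpose G F) :
    FunctionedSpace.IsMorphism F.groupTimesNilradical G.groupTimesNilradical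
      (dualityMap hFG hGF) := by
  have h1 : IsPolynomialMatrix (fun y : SpecialLinearGroup (Fin n) ℂ × F.nilradical =>
      Sum.elim (matrixCoord (mat y.1)) (matrixCoord y.2.1))
      fun y => mat (transposeInv (y.1 * h⁻¹)) := by
    refine IsPolynomialMatrix.transpose (IsPolynomialMatrix.mat_inv ?_)
    simp only [map_mul]
    exact (isPolynomialMatrix_fst F).mul (.const _)
  have h2 := ((IsPolynomialMatrix.const (mat h)).mul (isPolynomialMatrix_snd F)).mul
    (.const (mat h⁻¹)) |>.transpose
  refine FunctionedSpace.isMorphism_affine _ ?_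
  rintro (⟨a, b⟩ | ⟨a, b⟩)
  · exact h1 a b
  · exact h2 a b

theorem dualityMap_rel (hFG : IsDualPair h F G) (hGF : IsDualPair h.transpose G F)
    {y z : SpecialLinearGroup (Fin n) ℂ × F.nilradical} (hyz : F.orbitRel y z) :
    G.orbitRel (dualityMap hFG hGF y) (dualityMap hFG hGF z) := by
  obtain ⟨p, hp, h1, h2⟩ := hyz
  refine ⟨_, hGF.transposeInv_conj_mem_parabolic hp, ?_, ?_⟩
  · simp only [dualityMap]
    rw [h1, ← transposeInv_mul]
    congr 1
    group
  · simp only [dualityMap]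
    rw [h2, mat_transposeInv_inv, mat_transposeInv, ← transpose_mul, ← transpose_mul]
    congr 1
    have h3 : mat (h * p * h⁻¹)⁻¹ * mat h = mat h * mat p⁻¹ := by
      rw [← map_mul, ← map_mul]
      congr 1
      group
    have h4 : mat h⁻¹ * mat (h * p * h⁻¹) = mat p * mat h⁻¹ := by
      rw [← map_mul, ← map_mul]
      congr 1
      group
    calc _ = (mat h * mat p⁻¹) * y.2.1 * (mat p * mat h⁻¹) := by simp only [Matrix.mul_assoc]
      _ = _ := by rw [← h3, ← h4]; simp only [Matrix.mul_assoc]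

/-- `h.transpose.transpose` is definitionally `h`, so in `dualityIso` the hypothesis `hFG` itself
serves as `hFG'`. -/
theorem dualityMap_dualityMap (hFG : IsDualPair h F G) (hGF : IsDualPair h.transpose G F)
    (hFG' : IsDualPair h.transpose.transpose F G)
    (y : SpecialLinearGroup (Fin n) ℂ × F.nilradical) :
    dualityMap hGF hFG' (dualityMap hFG hGF y) = y := by
  refine Prod.ext ?_ (Subtype.ext ?_)
  · simp only [dualityMap]
    have hh : (transposeInv h.transpose)⁻¹ = h := mat_injective (mat_transposeInv_inv _)
    rw [transposeInv_mul, transposeInv_transposeInv, transposeInv_inv, hh, inv_mul_cancel_right]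
  · simp only [dualityMap]
    rw [transpose_inv_eq, mat_transposeInv, mat_transpose, ← transpose_mul, ← transpose_mul,
      transpose_transpose]
    calc _ = (mat h⁻¹ * mat h) * y.2.1 * (mat h⁻¹ * mat h) := by simp only [Matrix.mul_assoc]
      _ = _ := by rw [mat_inv_mul_mat, one_mul, mul_one]

/-- The isomorphism of cotangent bundles defined by a duality between two flags. -/
def dualityIso (hFG : IsDualPair h F G) (hGF : IsDualPair h.transpose G F) :
    FunctionedSpace.Iso F.cotangentBundle G.cotangentBundle where
  toEquiv :=
    { toFun := Quotient.map (sa := F.orbitRel) (sb := G.orbitRel) (dualityMap hFG hGF)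
        fun _ _ => dualityMap_rel hFG hGF
      invFun := Quotient.map (sa := G.orbitRel) (sb := F.orbitRel) (dualityMap hGF hFG)
        fun _ _ => dualityMap_rel hGF hFG
      left_inv := fun y => by
        induction y using Quotient.ind
        exact congrArg (Quotient.mk F.orbitRel) (dualityMap_dualityMap hFG hGF hFG _)
      right_inv := fun y => by
        induction y using Quotient.ind
        exact congrArg (Quotient.mk G.orbitRel) (dualityMap_dualityMap hGF hFG hGF _) }
  isMorphism := FunctionedSpace.isMorphism_of_comp_mk
    ((FunctionedSpace.isMorphism_mk _ _).comp (isMorphism_dualityMap hFG hGF))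
  isMorphism_symm := FunctionedSpace.isMorphism_of_comp_mk
    ((FunctionedSpace.isMorphism_mk _ _).comp (isMorphism_dualityMap hGF hFG))

/-- The factors h and h⁻¹ cancel, so the map induced on matrices is plain transposition whatever h
relates the two flags. -/
theorem springerMap_dualityIso (hFG : IsDualPair h F G) (hGF : IsDualPair h.transpose G F)
    (y : F.cotangentBundle) :
    G.springerMap ((dualityIso hFG hGF).toEquiv y) = (F.springerMap y)ᵀ := by
  induction y using Quotient.ind with
  | _ y =>
  change mat (transposeInv (y.1 * h⁻¹)) * (mat h * y.2.1 * mat h⁻¹)ᵀ *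
    mat (transposeInv (y.1 * h⁻¹))⁻¹ = (mat y.1 * y.2.1 * mat y.1⁻¹)ᵀ
  rw [mat_transposeInv_inv, mat_transposeInv, ← transpose_mul, ← transpose_mul]
  congr 1
  have h1 : mat y.1 = mat (y.1 * h⁻¹) * mat h := by rw [← map_mul, inv_mul_cancel_right]
  have h2 : mat y.1⁻¹ = mat h⁻¹ * mat (y.1 * h⁻¹)⁻¹ := by
    rw [← map_mul]
    congr 1
    group
  rw [h1, h2]
  simp only [Matrix.mul_assoc]

end Duality

theorem isMorphism_of_val_eq_springerMap {k : ℕ} {d : Fin k → ℕ} (F : PartialFlag n i)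
    (f : F.cotangentBundle → orbitClosure n d) (hf : ∀ y, (f y).val = F.springerMap y) :
    FunctionedSpace.IsMorphism F.cotangentBundle (orbitClosure n d) f := by
  refine FunctionedSpace.isMorphism_of_comp_mk (FunctionedSpace.isMorphism_affine _ ?_)
  rintro ⟨a, b⟩
  have h1 := (isPolynomialMatrix_fst F).mul (isPolynomialMatrix_snd F) |>.mul
    (isPolynomialMatrix_fst F).mat_inv
  convert h1 a b using 2 with y
  exact congrArg (fun A : Matrix (Fin n) (Fin n) ℂ => A a b) (hf (Quotient.mk _ y))

end PartialFlag

/-! ### Transposition on orbit closures -/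

section Transpose

open Matrix

theorem jordanBlock_transpose (r : ℕ) :
    (jordanBlock r)ᵀ = (jordanBlock r).submatrix Fin.rev Fin.rev := by
  ext a b
  simp only [jordanBlock, transpose_apply, of_apply, submatrix_apply, Fin.val_rev]
  congr 1
  have := a.2
  have := b.2
  simp only [eq_iff_iff]
  omega

/-- Reversing the order of the basis within each Jordan block turns the block into its transpose;
the renumbering is absorbed in `e`. -/
theorem transpose_mem_nilpotentOrbit {n k : ℕ} {d : Fin k → ℕ} {x : Matrix (Fin n) (Fin n) ℂ}
    (hx : x ∈ nilpotentOrbit n d) : xᵀ ∈ nilpotentOrbit n d := by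
  obtain ⟨e, g, rfl⟩ := hx
  let ρ : (Σ a, Fin (d a)) ≃ Σ a, Fin (d a) := Equiv.sigmaCongrRight fun _ => Fin.revPerm
  refine ⟨ρ.trans e, PartialFlag.transposeInv g, ?_⟩
  rw [PartialFlag.mat_transposeInv, PartialFlag.mat_transposeInv_inv, transpose_mul, transpose_mul,
    ← Matrix.mul_assoc]
  congr 2
  have h : (blockDiagonal' fun a => jordanBlock (d a))ᵀ =
      (blockDiagonal' fun a => jordanBlock (d a)).submatrix ρ ρ := by
    rw [blockDiagonal'_transpose]
    ext ⟨a, u⟩ ⟨b, v⟩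
    by_cases hab : a = b
    · subst hab
      simp [ρ, jordanBlock_transpose]
    · simp [ρ, blockDiagonal'_apply_ne _ _ _ hab]
  rw [transpose_reindex, h]
  ext u v
  simp [ρ]

theorem transpose_mem_zariskiClosure {n : ℕ} {S : Set (Matrix (Fin n) (Fin n) ℂ)}
    (hS : ∀ y ∈ S, yᵀ ∈ S) {x : Matrix (Fin n) (Fin n) ℂ} (hx : x ∈ zariskiClosure S) :
    xᵀ ∈ zariskiClosure S := by
  intro p hp
  have key : ∀ y : Matrix (Fin n) (Fin n) ℂ, MvPolynomial.eval (matrixCoord yᵀ) p =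
      MvPolynomial.eval (matrixCoord y) (MvPolynomial.rename Prod.swap p) := by
    intro y
    rw [MvPolynomial.eval_rename]
    rfl
  rw [key]
  exact hx _ fun y hy => by rw [← key]; exact hp _ (hS y hy)

/-- Transposition, as an automorphism of the closure of a nilpotent orbit. -/
def orbitClosure.transpose {n k : ℕ} (d : Fin k → ℕ) :
    FunctionedSpace.Iso (orbitClosure n d) (orbitClosure n d) :=
  let t : zariskiClosure (nilpotentOrbit n d) → zariskiClosure (nilpotentOrbit n d) :=
    fun x => ⟨x.1ᵀ, transpose_mem_zariskiClosure (fun _ => transpose_mem_nilpotentOrbit) x.2⟩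
  have ht : FunctionedSpace.IsMorphism (orbitClosure n d) (orbitClosure n d) t :=
    FunctionedSpace.isMorphism_affine _ fun a =>
      FunctionedSpace.coord_mem_polynomialFunctions _ (a.2, a.1)
  ⟨⟨t, t, fun _ => rfl, fun _ => rfl⟩, ht, ht⟩

theorem orbitClosure.val_injective {n k : ℕ} {d : Fin k → ℕ} :
    Function.Injective (orbitClosure.val (n := n) (d := d)) := Subtype.val_injective

end Transpose

/-! ### Semicontinuity of rank along a line -/

section GenericRank

open Matrix Polynomial

/-- A matrix lies in the Zariski closure of a set which contains all but finitely many points of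
some line through it. -/
theorem mem_zariskiClosure_of_line {n : ℕ} {S : Set (Matrix (Fin n) (Fin n) ℂ)}
    {A B : Matrix (Fin n) (Fin n) ℂ} {q : ℂ[X]} (hq : q ≠ 0)
    (h : ∀ t : ℂ, q.eval t ≠ 0 → A + t • (B - A) ∈ S) : A ∈ zariskiClosure S := by
  intro p hp
  let P : ℂ[X] := MvPolynomial.aeval
    (fun a : Fin n × Fin n => C (A a.1 a.2) + X * C (B a.1 a.2 - A a.1 a.2)) p
  have hP : ∀ t, P.eval t = MvPolynomial.eval (matrixCoord (A + t • (B - A))) p := by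
    intro t
    rw [← Polynomial.coe_evalRingHom, MvPolynomial.map_aeval, MvPolynomial.eval]
    congr 2
    · ext r
      simp
    · ext a
      simp [matrixCoord]
  -- P is p restricted to the line. It vanishes wherever q does not, so P q is zero as a function,
  -- hence as a polynomial; thus P = 0, in particular at t = 0.
  have h0 : P * q = 0 := by
    refine Polynomial.funext fun t => ?_
    rw [eval_mul, eval_zero, mul_eq_zero, or_iff_not_imp_right]
    intro ht
    rw [hP]
    exact hp _ (h t ht)
  have h1 := hP 0
  rw [(mul_eq_zero.1 h0).resolve_right hq, eval_zero, zero_smul, add_zero] at h1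
  exact h1.symm

/-- This certifies the rank by a single determinant det (P M Q) = 1, which depends polynomially on
M. -/
theorem exists_mul_mul_eq_one {n : ℕ} (M : Matrix (Fin n) (Fin n) ℂ) :
    ∃ (P : Matrix (Fin M.rank) (Fin n) ℂ) (Q : Matrix (Fin n) (Fin M.rank) ℂ), P * M * Q = 1 := by
  obtain ⟨V, U, e, -, -, h⟩ := M.exists_rank_normal_form
  refine ⟨V.submatrix (e.symm ∘ Sum.inl) id, U.submatrix id (e.symm ∘ Sum.inl), ?_⟩
  have h1 : V.submatrix (e.symm ∘ Sum.inl) id * M * U.submatrix id (e.symm ∘ Sum.inl) =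
      (V * M * U).submatrix (e.symm ∘ Sum.inl) (e.symm ∘ Sum.inl) := rfl
  rw [h1, h]
  ext a b
  simp

/-- On a line of matrices, the rank of a power is at least as large as at a given point, with
finitely many exceptions. -/
theorem exists_rank_pow_le {n : ℕ} (A B : Matrix (Fin n) (Fin n) ℂ) (l : ℕ) :
    ∃ q : ℂ[X], q ≠ 0 ∧ ∀ t : ℂ, q.eval t ≠ 0 → (B ^ l).rank ≤ ((A + t • (B - A)) ^ l).rank := by
  obtain ⟨P, Q, hPQ⟩ := exists_mul_mul_eq_one (B ^ l)
  let L : Matrix (Fin n) (Fin n) ℂ[X] := A.map C + (X : ℂ[X]) • (B - A).map C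
  let q : ℂ[X] := (P.map C * L ^ l * Q.map C).det
  have hL : ∀ t, (evalRingHom t).mapMatrix L = A + t • (B - A) := by
    intro t
    ext a b
    simp [L]
  have hq : ∀ t, q.eval t = (P * (A + t • (B - A)) ^ l * Q).det := by
    intro t
    have hC : ∀ {u v : ℕ} (M : Matrix (Fin u) (Fin v) ℂ),
        (M.map C).map (evalRingHom t) = M := by
      intro u v M
      ext a b
      simp
    rw [← coe_evalRingHom, RingHom.map_det, RingHom.mapMatrix_apply, Matrix.map_mul, Matrix.map_mul,
      hC, hC, ← RingHom.mapMatrix_apply, map_pow, hL]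
  refine ⟨q, fun h0 => ?_, fun t ht => ?_⟩
  -- The line reaches B at t = 1, where the determinant is 1; so q is not the zero polynomial.
  · have h1 := hq 1
    rw [h0, one_smul, add_sub_cancel, hPQ, eval_zero, det_one] at h1
    exact zero_ne_one h1
  · rw [hq] at ht
    have h1 := rank_of_det_ne_zero ht
    rw [Fintype.card_fin] at h1
    rw [← h1]
    exact (rank_mul_le_left _ _).trans (rank_mul_le_right _ _)

end GenericRank

/-! ### Rank bounds on the nilradical -/

namespace PartialFlag

open Matrix Module

variable {n m : ℕ} {i : Fin m → ℕ}

/-- Climb the flag. At a step in `A`, one factor x pushes the new subspace back into the previous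
one; at any other step, the dimension of the image grows by at most the size of the step. -/
theorem finrank_map_pow_le (F : PartialFlag n i) {x : Matrix (Fin n) (Fin n) ℂ}
    (hx : x ∈ F.nilradical) (A : Finset (Fin m)) (j : Fin (m + 1)) :
    finrank ℂ ((F.V j).map (toLin' x ^ (A.filter fun a => a.castSucc < j).card)) ≤
      ∑ a ∈ Aᶜ with a.castSucc < j, i a := by
  induction j using Fin.induction with
  | zero => simp [F.bot]
  | succ j ih =>
    have hle : F.V j.castSucc ≤ F.V j.succ := F.mono j.castSucc_le_succ
    have hins : ∀ B : Finset (Fin m), (B.filter fun a => a.castSucc < j.succ) =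
        if j ∈ B then insert j (B.filter fun a => a.castSucc < j.castSucc)
        else B.filter fun a => a.castSucc < j.castSucc := by
      intro B
      split_ifs with hB <;> ext a <;>
        simp only [Finset.mem_filter, Finset.mem_insert, Fin.castSucc_lt_succ_iff,
          Fin.castSucc_lt_castSucc_iff, le_iff_eq_or_lt]
      · refine ⟨fun h => h.2.imp_right fun h' => ⟨h.1, h'⟩, ?_⟩
        rintro (rfl | h)
        · exact ⟨hB, Or.inl rfl⟩
        · exact ⟨h.1, Or.inr h.2⟩
      · refine and_congr_right fun ha => or_iff_right ?_
        rintro rfl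
        exact hB ha
    by_cases hj : j ∈ A
    · rw [hins, hins, if_pos hj, if_neg (by simpa using hj), Finset.card_insert_of_notMem (by simp),
        pow_succ, Module.End.mul_eq_comp, Submodule.map_comp]
      refine le_trans (Submodule.finrank_mono (Submodule.map_mono ?_)) ih
      rintro _ ⟨v, hv, rfl⟩
      exact hx j v hv
    · rw [hins, hins, if_neg hj, if_pos (by simpa using hj), Finset.sum_insert (by simp)]
      set T := toLin' x ^ (A.filter fun a => a.castSucc < j.castSucc).card
      obtain ⟨C, hC⟩ := (F.V j.castSucc).exists_isCompl
      have hsup : F.V j.castSucc ⊔ (C ⊓ F.V j.succ) = F.V j.succ := by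
        rw [← sup_inf_assoc_of_le _ hle, hC.sup_eq_top, top_inf_eq]
      have h := Submodule.finrank_sup_add_finrank_inf_eq (F.V j.castSucc) (C ⊓ F.V j.succ)
      rw [hsup, ← inf_assoc, hC.inf_eq_bot, bot_inf_eq, finrank_bot, F.dim] at h
      have h1 : finrank ℂ ((C ⊓ F.V j.succ).map T) ≤ i j :=
        (Submodule.finrank_map_le _ _).trans (by omega)
      have h2 := Submodule.finrank_add_le_finrank_add_finrank ((F.V j.castSucc).map T)
        ((C ⊓ F.V j.succ).map T)
      rw [← Submodule.map_sup, hsup] at h2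
      omega

/-- An upper bound for the ranks of the powers of the elements of the nilradical. -/
theorem rank_pow_card_le (F : PartialFlag n i) {x : Matrix (Fin n) (Fin n) ℂ}
    (hx : x ∈ F.nilradical) (A : Finset (Fin m)) : (x ^ A.card).rank ≤ ∑ a ∈ Aᶜ, i a := by
  have h := F.finrank_map_pow_le hx A (Fin.last m)
  have hlast : ∀ B : Finset (Fin m), (B.filter fun a => a.castSucc < Fin.last m) = B :=
    fun B => Finset.filter_true_of_mem fun a _ => a.castSucc_lt_last
  rw [hlast, hlast, F.top, Submodule.map_top, ← toLin'_pow, toLin'_apply'] at h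
  exact h

theorem isNilpotent_of_mem_nilradical (F : PartialFlag n i) {x : Matrix (Fin n) (Fin n) ℂ}
    (hx : x ∈ F.nilradical) : IsNilpotent (toLin' x) := by
  have h := F.rank_pow_card_le hx Finset.univ
  rw [Finset.compl_univ, Finset.sum_empty, Nat.le_zero, Matrix.rank, ← toLin'_apply', toLin'_pow,
    Submodule.finrank_eq_zero, LinearMap.range_eq_bot] at h
  exact ⟨_, h⟩

end PartialFlag

/-! ### Jordan bases -/

section JordanForm

open Matrix Module

variable {k : ℕ} {d : Fin k → ℕ} {V : Type} [AddCommGroup V] [Module ℂ V]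

/-- The nilpotent endomorphism with Jordan blocks of sizes `d a`, with respect to a basis. -/
noncomputable def jordanEnd (c : Basis (Σ a, Fin (d a)) ℂ V) : End ℂ V :=
  toLin c c (blockDiagonal' fun a => jordanBlock (d a))

theorem jordanEnd_zero (c : Basis (Σ a, Fin (d a)) ℂ V) (a : Fin k) (h : 0 < d a) :
    jordanEnd c (c ⟨a, 0, h⟩) = 0 := by
  rw [jordanEnd, toLin_self]
  refine Finset.sum_eq_zero ?_
  rintro ⟨a', b'⟩ -
  by_cases haa : a' = a
  · subst haa
    simp [blockDiagonal'_apply_eq, jordanBlock]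
  · rw [blockDiagonal'_apply_ne _ _ _ haa, zero_smul]

theorem jordanEnd_succ (c : Basis (Σ a, Fin (d a)) ℂ V) (a : Fin k) (b : ℕ) (h : b + 1 < d a) :
    jordanEnd c (c ⟨a, b + 1, h⟩) = c ⟨a, b, (Nat.lt_succ_self b).trans h⟩ := by
  rw [jordanEnd, toLin_self, Finset.sum_eq_single ⟨a, b, (Nat.lt_succ_self b).trans h⟩]
  · simp [blockDiagonal'_apply_eq, jordanBlock]
  · rintro ⟨a', b'⟩ - hne
    by_cases haa : a' = a
    · subst haa
      have hb : (b' : ℕ) ≠ b := fun hb => hne (by subst hb; rfl)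
      simp [blockDiagonal'_apply_eq, jordanBlock, hb]
    · rw [blockDiagonal'_apply_ne _ _ _ haa, zero_smul]
  · simp

theorem jordanEnd_pow_add (c : Basis (Σ a, Fin (d a)) ℂ V) (a : Fin k) (b l : ℕ) (h : b + l < d a) :
    (jordanEnd c ^ l) (c ⟨a, b + l, h⟩) = c ⟨a, b, (Nat.le_add_right b l).trans_lt h⟩ := by
  induction l with
  | zero => rfl
  | succ l ih =>
    rw [pow_succ, Module.End.mul_apply]
    erw [jordanEnd_succ c a (b + l) h]
    exact ih _

/-- The first d a - l vectors of each row are images under the l-th power; truncated subtraction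
discards rows of length at most l. -/
theorem sum_sub_le_finrank_range_jordanEnd_pow [FiniteDimensional ℂ V]
    (c : Basis (Σ a, Fin (d a)) ℂ V) (l : ℕ) :
    ∑ a, (d a - l) ≤ finrank ℂ (LinearMap.range (jordanEnd c ^ l)) := by
  let ι : (Σ a, Fin (d a - l)) → Σ a, Fin (d a) := Sigma.map id fun a => Fin.castLE (Nat.sub_le _ _)
  have hι : Function.Injective ι :=
    Function.injective_id.sigma_map fun a => Fin.castLE_injective _
  have h := finrank_span_eq_card (c.linearIndependent.comp ι hι)
  rw [Fintype.card_sigma] at h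
  simp only [Fintype.card_fin] at h
  rw [← h]
  refine Submodule.finrank_mono (Submodule.span_le.2 ?_)
  rintro _ ⟨⟨a, b⟩, rfl⟩
  have hb : b.1 + l < d a := by
    have := b.2
    omega
  exact ⟨_, jordanEnd_pow_add c a b.1 l hb⟩

/-- The matrix of an endomorphism with a Jordan basis is in the nilpotent orbit. -/
theorem mem_nilpotentOrbit_of_basis {n : ℕ} (c : Basis (Σ a, Fin (d a)) ℂ (Fin n → ℂ))
    {x : Matrix (Fin n) (Fin n) ℂ} (hx : toLin' x = jordanEnd c) : x ∈ nilpotentOrbit n d := by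
  have hcard : Fintype.card (Σ a, Fin (d a)) = n := by
    rw [← finrank_eq_card_basis c, finrank_fin_fun]
  let e := Fintype.equivFinOfCardEq hcard
  let E := (Pi.basisFun ℂ (Fin n)).equiv c e.symm
  obtain ⟨g, r, hr, hg⟩ := exists_mat_eq_smul E
  set D : Matrix (Σ a, Fin (d a)) (Σ a, Fin (d a)) ℂ :=
    blockDiagonal' fun a => jordanBlock (d a) with hD
  have hE : ∀ u, E (Pi.single u 1) = c (e.symm u) := by
    intro u
    rw [← Pi.basisFun_apply, Basis.equiv_apply]
  have hcomm : toLin' x ∘ₗ E.toLinearMap = E.toLinearMap ∘ₗ toLin' (reindex e e D) := by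
    refine (Pi.basisFun ℂ (Fin n)).ext fun u => ?_
    rw [Pi.basisFun_apply, hx, LinearMap.comp_apply, LinearMap.comp_apply, LinearEquiv.coe_coe, hE,
      jordanEnd, toLin_self, toLin'_apply, mulVec_single_one, ← hD]
    have hcol : (reindex e e D).col u = ∑ w, D (e.symm w) (e.symm u) • Pi.single w (1 : ℂ) := by
      ext v
      simp [Finset.sum_apply, Pi.single_apply]
    rw [hcol, map_sum, ← Equiv.sum_comp e.symm]
    refine Finset.sum_congr rfl fun w _ => ?_
    rw [map_smul, hE]
  have h1 : x * mat g = mat g * reindex e e D := by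
    have h2 := congrArg LinearMap.toMatrix' hcomm
    rw [LinearMap.toMatrix'_comp, LinearMap.toMatrix'_comp, LinearMap.toMatrix'_toLin',
      LinearMap.toMatrix'_toLin'] at h2
    rw [hg, Matrix.mul_smul, h2, Matrix.smul_mul]
  refine ⟨e, g, ?_⟩
  rw [← h1, Matrix.mul_assoc, mat_mul_mat_inv, mul_one]

end JordanForm

/-! ### Counting boxes of the Young diagram -/

theorem le_dualLength {k : ℕ} (d : Fin k → ℕ) (a : Fin k) : d a ≤ dualLength d :=
  Finset.le_sup (Finset.mem_univ a)

theorem card_lt_perm {k : ℕ} (d : Fin k → ℕ) (σ : Equiv.Perm (Fin (dualLength d))) (a : Fin k) :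
    Fintype.card {j : Fin (dualLength d) // (σ j : ℕ) < d a} = d a := by
  let q : Fin (dualLength d) → Prop := fun j => (j : ℕ) < d a
  let e : {j : Fin (dualLength d) // (σ j : ℕ) < d a} ≃ {j // q j} :=
    σ.subtypeEquiv fun _ => Iff.rfl
  rw [Fintype.card_congr (e.trans (Fin.castLEquiv (le_dualLength d a)).symm), Fintype.card_fin]

theorem val_perm_injective {m : ℕ} (σ : Equiv.Perm (Fin m)) :
    Function.Injective fun j => (σ j : ℕ) :=
  Fin.val_injective.comp σ.injective

/-- Double counting of the boxes outside the first l columns: by columns on the left, by rows on the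
right. -/
theorem sum_dualPart_le {k : ℕ} (d : Fin k → ℕ) (σ : Equiv.Perm (Fin (dualLength d))) (l : ℕ) :
    ∑ j ∈ (Finset.univ.filter fun j => (σ j : ℕ) < l)ᶜ, dualPart d (σ j) ≤ ∑ a, (d a - l) := by
  have h := Finset.sum_card_bipartiteAbove_eq_sum_card_bipartiteBelow
    (s := (Finset.univ.filter fun j => (σ j : ℕ) < l)ᶜ) (t := Finset.univ)
    (r := fun j a => (σ j : ℕ) < d a)
  refine h.le.trans (Finset.sum_le_sum fun a _ => ?_)
  rw [← Nat.card_Ico]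
  refine Finset.card_le_card_of_injOn (fun j => (σ j : ℕ)) ?_ (val_perm_injective σ).injOn
  intro j hj
  simpa [Finset.bipartiteBelow] using hj

theorem card_filter_perm_lt_le {m : ℕ} (σ : Equiv.Perm (Fin m)) (l : ℕ) :
    (Finset.univ.filter fun j => (σ j : ℕ) < l).card ≤ l := by
  conv_rhs => rw [← Finset.card_range l]
  refine Finset.card_le_card_of_injOn (fun j => (σ j : ℕ)) ?_ (val_perm_injective σ).injOn
  intro j hj
  simpa using hj

/-! ### The Springer map lands in the orbit closure -/

namespace PartialFlag

open Matrix Module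

variable {n k : ℕ} {d : Fin k → ℕ} {σ : Equiv.Perm (Fin (dualLength d))}

/-- A flag whose type is a permutation of the dual partition has an adapted basis in which the
vectors of each row of the Young diagram lie in increasing steps of the flag. -/
theorem exists_basis_rows (F : PartialFlag n (fun j => dualPart d (σ j))) :
    ∃ (c : Basis (Σ a, Fin (d a)) ℂ (Fin n → ℂ)) (o : ∀ a, Fin (d a) → Fin (dualLength d)),
      (∀ a, StrictMono (o a)) ∧
      ∀ j, F.V j = Submodule.span ℂ (c '' {p | (o p.1 p.2).castSucc < j}) := by
  obtain ⟨b, hb⟩ := F.exists_adapted_basis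
  -- Flag step j corresponds to column σ j. For each row, `o a` lists in increasing order the steps
  -- whose column meets that row; the bijections below regroup boxes from rows to columns.
  let o : ∀ a, Fin (d a) ≃o {j : Fin (dualLength d) // (σ j : ℕ) < d a} :=
    fun a => Fintype.orderIsoFinOfCardEq _ (card_lt_perm d σ a)
  let κ₁ : (Σ a, Fin (d a)) ≃ Σ a, {j : Fin (dualLength d) // (σ j : ℕ) < d a} :=
    Equiv.sigmaCongrRight fun a => (o a).toEquiv
  let κ₂ : (Σ a, {j : Fin (dualLength d) // (σ j : ℕ) < d a}) ≃
      Σ j : Fin (dualLength d), {a // (σ j : ℕ) < d a} :=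
    { toFun := fun p => ⟨p.2.1, p.1, p.2.2⟩
      invFun := fun p => ⟨p.2.1, p.1, p.2.2⟩
      left_inv := fun _ => rfl
      right_inv := fun _ => rfl }
  let κ₃ : (Σ j : Fin (dualLength d), {a // (σ j : ℕ) < d a}) ≃ Σ j, Fin (dualPart d (σ j)) :=
    Equiv.sigmaCongrRight fun j => Fintype.equivFinOfCardEq (Fintype.card_subtype _)
  let κ := (κ₁.trans κ₂).trans κ₃
  refine ⟨b.reindex κ.symm, fun a b => (o a b).1, fun a => (o a).strictMono, fun j => ?_⟩
  rw [hb]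
  congr 1
  have hset : {p : Σ j, Fin (dualPart d (σ j)) | p.1.castSucc < j} =
      κ '' {p | (o p.1 p.2).1.castSucc < j} := by
    ext p
    constructor
    · intro hp
      obtain ⟨p, rfl⟩ := κ.surjective p
      exact ⟨p, hp, rfl⟩
    · rintro ⟨p, hp, rfl⟩
      exact hp
  rw [hset, ← Set.image_comp]
  refine Set.image_congr fun p _ => ?_
  simp

/-- The nilradical contains an element with a Jordan basis of type `d`. -/
theorem exists_jordanEnd_mem_nilradical (F : PartialFlag n (fun j => dualPart d (σ j))) :
    ∃ (c : Basis (Σ a, Fin (d a)) ℂ (Fin n → ℂ)) (y : Matrix (Fin n) (Fin n) ℂ),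
      toLin' y = jordanEnd c ∧ y ∈ F.nilradical := by
  obtain ⟨c, o, ho, hV⟩ := F.exists_basis_rows
  refine ⟨c, LinearMap.toMatrix' (jordanEnd c), toLin'_toMatrix' _, fun j v hv => ?_⟩
  rw [LinearMap.toMatrix'_mulVec]
  have hle : F.V j.succ ≤ (F.V j.castSucc).comap (jordanEnd c) := by
    rw [hV j.succ, Submodule.span_le]
    rintro _ ⟨⟨a, b, hba⟩, hb, rfl⟩
    rw [SetLike.mem_coe, Submodule.mem_comap]
    cases b with
    | zero =>
      rw [jordanEnd_zero]
      exact zero_mem _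
    | succ b =>
      rw [jordanEnd_succ, hV]
      refine Submodule.subset_span ⟨_, ?_, rfl⟩
      -- The Jordan endomorphism moves a basis vector one place back in its row, hence to a strictly
      -- earlier flag step.
      have h1 : o a ⟨b, (Nat.lt_succ_self b).trans hba⟩ < o a ⟨b + 1, hba⟩ :=
        ho a (Fin.mk_lt_mk.2 (Nat.lt_succ_self b))
      exact Fin.castSucc_lt_castSucc_iff.2 (h1.trans_le (Fin.castSucc_lt_succ_iff.1 hb))
  exact hle hv

/-- Apply the subset bound to the steps carrying the first, hence longest, l columns. If there are
fewer than l columns, the surplus factors of x cannot raise the rank. -/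
theorem rank_pow_le (F : PartialFlag n (fun j => dualPart d (σ j)))
    {x : Matrix (Fin n) (Fin n) ℂ} (hx : x ∈ F.nilradical) (l : ℕ) :
    (x ^ l).rank ≤ ∑ a, (d a - l) := by
  refine le_trans ?_ ((F.rank_pow_card_le hx _).trans (sum_dualPart_le d σ l))
  obtain ⟨r, hr⟩ := Nat.exists_eq_add_of_le' (card_filter_perm_lt_le σ l)
  conv_lhs => rw [hr, pow_add]
  exact rank_mul_le_right _ _

/-- The conjugates of the elements of the nilradical lie in the closure of the orbit. -/
theorem conj_mem_zariskiClosure (F : PartialFlag n (fun j => dualPart d (σ j)))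
    (g : SpecialLinearGroup (Fin n) ℂ) {x : Matrix (Fin n) (Fin n) ℂ} (hx : x ∈ F.nilradical) :
    mat g * x * mat g⁻¹ ∈ zariskiClosure (nilpotentOrbit n d) := by
  obtain ⟨c, y, hyc, hy⟩ := F.exists_jordanEnd_mem_nilradical
  have hyrank : ∀ l, ∑ a, (d a - l) ≤ (y ^ l).rank := by
    intro l
    rw [Matrix.rank, ← toLin'_apply', toLin'_pow, hyc]
    exact sum_sub_le_finrank_range_jordanEnd_pow c l
  choose q hq hqrank using fun l => exists_rank_pow_le x y l
  have hconj : ∀ z ∈ nilpotentOrbit n d, mat g * z * mat g⁻¹ ∈ nilpotentOrbit n d := by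
    rintro _ ⟨e, h, rfl⟩
    refine ⟨e, g * h, ?_⟩
    rw [_root_.mul_inv_rev, map_mul, map_mul]
    simp only [Matrix.mul_assoc]
  -- Finitely many exponents suffice: from `dualLength d` on, the upper bound already forces all
  -- ranks to be zero.
  refine mem_zariskiClosure_of_line (B := mat g * y * mat g⁻¹)
    (q := ∏ l ∈ Finset.range (dualLength d), q l) (Finset.prod_ne_zero_iff.2 fun l _ => hq l)
    fun t ht => ?_
  rw [Polynomial.eval_prod, Finset.prod_ne_zero_iff] at ht
  have hline : mat g * x * mat g⁻¹ + t • (mat g * y * mat g⁻¹ - mat g * x * mat g⁻¹) =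
      mat g * (x + t • (y - x)) * mat g⁻¹ := by
    simp only [Matrix.mul_add, Matrix.add_mul, Matrix.mul_sub, Matrix.sub_mul, Matrix.mul_smul,
      Matrix.smul_mul, smul_sub]
  rw [hline]
  refine hconj _ ?_
  have hz : x + t • (y - x) ∈ F.nilradical :=
    add_mem hx (Submodule.smul_mem _ _ (sub_mem hy hx))
  set z := x + t • (y - x)
  have hrank : ∀ l, (y ^ l).rank = (z ^ l).rank := by
    intro l
    by_cases hl : l < dualLength d
    · exact le_antisymm (hqrank l t (ht l (Finset.mem_range.2 hl)))
        ((F.rank_pow_le hz l).trans (hyrank l))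
    · have h0 : ∑ a, (d a - l) = 0 := Finset.sum_eq_zero fun a _ => by
        have := le_dualLength d a
        omega
      have h1 := F.rank_pow_le hz l
      have h2 := F.rank_pow_le hy l
      omega
  obtain ⟨e, he⟩ := exists_intertwining_of_finrank_range_pow_eq n (toLin' y) (toLin' z)
    (finrank_fin_fun ℂ) (F.isNilpotent_of_mem_nilradical hy) (F.isNilpotent_of_mem_nilradical hz)
    fun l => by
      rw [← toLin'_pow, ← toLin'_pow]
      exact hrank l
  refine mem_nilpotentOrbit_of_basis (c.map e) ((c.map e).ext fun p => ?_)
  rw [Basis.map_apply, ← he, hyc, jordanEnd, jordanEnd, toLin_self, ← Basis.map_apply, toLin_self,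
    map_sum]
  simp

theorem springerMap_mem_zariskiClosure (F : PartialFlag n (fun j => dualPart d (σ j)))
    (y : F.cotangentBundle) : F.springerMap y ∈ zariskiClosure (nilpotentOrbit n d) := by
  induction y using Quotient.ind with
  | _ y => exact F.conj_mem_zariskiClosure y.1 y.2.2

/-- The Springer map, as a morphism to the closure of the orbit. -/
def springerHom (F : PartialFlag n (fun j => dualPart d (σ j))) :
    FunctionedSpace.Hom F.cotangentBundle (orbitClosure n d) where
  toFun y := (⟨F.springerMap y, F.springerMap_mem_zariskiClosure y⟩ :
    zariskiClosure (nilpotentOrbit n d))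
  isMorphism := F.isMorphism_of_val_eq_springerMap _ fun _ => rfl

end PartialFlag

/-! ### The equivalence of the two resolutions -/

theorem proposition3p6 {n k : ℕ} (d : Fin k → ℕ) (hd : Antitone d) (hpos : ∀ i, 0 < d i)
    (hsum : ∑ i, d i = n) (σ : Equiv.Perm (Fin (dualLength d)))
    (F : PartialFlag n (fun j => dualPart d (σ j)))
    (F' : PartialFlag n (fun j => dualPart d (σ (Fin.rev j)))) :
    ∃ (π : FunctionedSpace.Hom F.cotangentBundle (orbitClosure n d))
      (π' : FunctionedSpace.Hom F'.cotangentBundle (orbitClosure n d)),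
      (∀ y, orbitClosure.val (π.toFun y) = F.springerMap y) ∧
      (∀ y, orbitClosure.val (π'.toFun y) = F'.springerMap y) ∧
      π.Equivalent π' := by
  obtain ⟨h, hF'F, hFF'⟩ := F.exists_isDualPair F'
  -- The reversed type is again a permutation of the dual partition, with σ precomposed with
  -- reversal, so the same construction gives π'.
  refine ⟨F.springerHom, PartialFlag.springerHom (σ := Fin.revPerm.trans σ) F', fun _ => rfl,
    fun _ => rfl, orbitClosure.transpose d, PartialFlag.dualityIso hF'F hFF', fun y => ?_⟩
  refine orbitClosure.val_injective ?_
  change (F.springerMap ((PartialFlag.dualityIso hF'F hFF').toEquiv y)).transpose = F'.springerMap y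
  rw [PartialFlag.springerMap_dualityIso, Matrix.transpose_transpose]
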